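/- Let $X\neq\{0\}$ be a Banach space over $\mathbb K\in\{\mathbb R,\mathbb C\}$, and let $G$ be a group of surjective linear isometries of $X$ that is compact in the topology inherited from the space $\mathcal L(X)$ of bounded operators (operator norm). Let $X^*_G=\{f\in X^*: f(g(x))=f(x)\text{ for all }g\in G,\ x\in X\}$ be the space of $G$-invariant functionals, and let $NA(X)$ be the set of $f\in X^*$ for which there is $x\in X$ with $\|x\|=1$ and $f(x)=\|f\|$. Suppose that $X^*$ is $G$-strongly subdifferentiable ($G$-SSD), that is, for every $u^*\in X^*_G$ with $\|u^*\|=1$ the limit $$\lim_{t\to0^+}\frac{\|u^*+t\,x^*\|-1}{t}$$ exists uniformly for $x^*\in X^*_G$ with $\|x^*\|\le 1$. Then every $G$-invariant functional $f\in X^*_G$ attains its norm, i.e. there is $x\in X$ with $\|x\|=1$ and $f(x)=\|f\|$. Consequently $X^*_G$ is a closed linear subspace of $X^*$ that is contained in $NA(X)$. -/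

import Mathlib

open Filter Topology

namespace GroupInvariant

variable {𝕜 : Type*} [RCLike 𝕜] {X : Type*} [NormedAddCommGroup X] [NormedSpace 𝕜 X]

/-- The elements of a group `G` of surjective linear isometries of `X`, as a subset of the space
`𝓛(X)` of bounded operators, which carries the operator norm topology. -/
def operators (G : Subgroup (X ≃ₗᵢ[𝕜] X)) : Set (X →L[𝕜] X) :=
  {T | ∃ g ∈ G, ∀ x, T x = g x}

/-- The group `G` is compact in the topology inherited from `𝓛(X)`. -/
def IsCompactGroup (G : Subgroup (X ≃ₗᵢ[𝕜] X)) : Prop :=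
  IsCompact (operators G)

/-- The adjoints `T* : X* → X*`, `T* f = f ∘ T`, of the operators `T` in `Γ`. For `Γ = G` this is
the dual group `G*`. -/
def dualOperators (Γ : Set (X →L[𝕜] X)) : Set (StrongDual 𝕜 X →L[𝕜] StrongDual 𝕜 X) :=
  {S | ∃ T ∈ Γ, ∀ f : StrongDual 𝕜 X, S f = f.comp T}

/-- The subspace `X_Γ` of the points of `X` that are fixed by every operator in `Γ`. -/
def invariantPoints (Γ : Set (X →L[𝕜] X)) : Submodule 𝕜 X where
  carrier := {x | ∀ T ∈ Γ, T x = x}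
  add_mem' := by
    intro a b ha hb T hT
    rw [map_add, ha T hT, hb T hT]
  zero_mem' := by
    intro T _
    exact map_zero T
  smul_mem' := by
    intro c x hx T hT
    rw [map_smul, hx T hT]

/-- The space `X*_G` of the `G`-invariant continuous linear functionals on `X`. -/
def invariantFunctionals (G : Subgroup (X ≃ₗᵢ[𝕜] X)) : Submodule 𝕜 (StrongDual 𝕜 X) where
  carrier := {f | ∀ g ∈ G, ∀ x, f (g x) = f x}
  add_mem' := by
    intro a b ha hb g hg x
    rw [add_apply, add_apply, ha g hg x, hb g hg x]
  zero_mem' := by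
    intro g _ x
    rfl
  smul_mem' := by
    intro c f hf g hg x
    rw [smul_apply, smul_apply, hf g hg x]

/-- The norm is strongly subdifferentiable at `u` relative to `Γ`: the limit
`τ x = lim_{t → 0⁺} (‖u + t x‖ - 1) / t` exists uniformly for `x` in the closed unit ball
of `X_Γ`. -/
def IsSSDAt (Γ : Set (X →L[𝕜] X)) (u : X) : Prop :=
  ∃ τ : X → ℝ,
    TendstoUniformlyOn (fun (t : ℝ) (x : X) => (‖u + (t : 𝕜) • x‖ - 1) / t) τ (𝓝[>] (0 : ℝ))
      {x | x ∈ invariantPoints Γ ∧ ‖x‖ ≤ 1}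

/-- The space `X` is strongly subdifferentiable relative to `Γ`: this holds at every `u` in the
unit sphere of `X_Γ`. -/
def IsSSD (Γ : Set (X →L[𝕜] X)) : Prop :=
  ∀ u ∈ invariantPoints Γ, ‖u‖ = 1 → IsSSDAt Γ u

/-- `X*` is `G`-strongly subdifferentiable, `G` acting on `X*` through the dual group `G*`. -/
def DualIsGSSD (G : Subgroup (X ≃ₗᵢ[𝕜] X)) : Prop :=
  IsSSD (dualOperators (operators G))

variable (𝕜 X) in
/-- The set `NA(X)` of the functionals that attain their norm at a point of the unit sphere. -/
def NA : Set (StrongDual 𝕜 X) :=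
  {f | ∃ x : X, ‖x‖ = 1 ∧ f x = (‖f‖ : 𝕜)}

/-- The points of `X*` fixed by `G*` are the `G`-invariant functionals. -/
theorem invariantPoints_dualOperators (G : Subgroup (X ≃ₗᵢ[𝕜] X)) :
    invariantPoints (dualOperators (operators G)) = invariantFunctionals G := by
  ext f
  constructor
  · intro h g hg x
    have := h (ContinuousLinearMap.precomp 𝕜 (g.toContinuousLinearEquiv : X →L[𝕜] X))
      ⟨_, ⟨g, hg, fun _ => rfl⟩, fun _ => rfl⟩
    exact congrArg (fun f : StrongDual 𝕜 X => f x) this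
  · rintro h S ⟨T, ⟨g, hg, hT⟩, hS⟩
    ext x
    rw [hS, ContinuousLinearMap.comp_apply, hT, h g hg x]

end GroupInvariant

/-!
Averaging over the Haar measure of `G` gives a contractive projection `P` of `X` onto the space
`X_G` of fixed points with `P ∘ g = P` for `g ∈ G`, so `h ↦ h ∘ P` identifies the dual of `X_G` with
`X*_G` isometrically, and it is enough to show that a functional `f` of norm one on a Banach space
attains its norm when the dual norm is strongly subdifferentiable at `f` in all directions, that is,
relative to `Γ = ∅`.
By Hahn-Banach, strong subdifferentiability at `f` makes every point of a thin slice
`1 - δ < re f` of the unit ball `ε`-close to every thinner slice. A sequence that passes through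
thinner and thinner slices with summable steps is therefore available, and its limit is a point
where `f` equals one.
-/

namespace GroupInvariant

section NormAttainment

variable {𝕜 : Type*} [RCLike 𝕜] {Y : Type*} [NormedAddCommGroup Y] [NormedSpace 𝕜 Y]

theorem re_apply_add_mul_norm_le {f : StrongDual 𝕜 Y} {x : Y} {r C : ℝ} (hr : 0 < r)
    (hC : ∀ y ∈ Metric.ball x r, RCLike.re (f y) ≤ C) : RCLike.re (f x) + r * ‖f‖ ≤ C := by
  suffices ‖f‖ ≤ (C - RCLike.re (f x)) / r by
    rw [le_div_iff₀ hr] at this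
    linarith
  by_contra! hlt
  obtain ⟨z, hz, hfz⟩ := f.exists_lt_apply_of_lt_opNorm hlt
  obtain ⟨c, hc, hcz⟩ := RCLike.exists_norm_eq_mul_self (f z)
  have hmem : x + (r * c : 𝕜) • z ∈ Metric.ball x r := by
    simpa [norm_smul, hc, abs_of_pos hr] using mul_lt_mul_of_pos_left hz hr
  have hre : RCLike.re (f (x + (r * c : 𝕜) • z)) = RCLike.re (f x) + r * ‖f z‖ := by
    rw [map_add, map_smul, smul_eq_mul, mul_assoc, ← hcz, map_add, RCLike.re_ofReal_mul,
      RCLike.ofReal_re]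
  rw [div_lt_iff₀ hr] at hfz
  linarith [hC _ hmem]

theorem exists_mem_closedBall_lt_re_apply {f : StrongDual 𝕜 Y} {a : ℝ} (ha : a < ‖f‖) :
    ∃ y ∈ Metric.closedBall (0 : Y) 1, a < RCLike.re (f y) := by
  by_contra! hle
  have := re_apply_add_mul_norm_le one_pos fun y hy ↦ hle y (Metric.ball_subset_closedBall hy)
  simp only [map_zero, one_mul, zero_add] at this
  exact this.not_gt ha

theorem exists_norm_eq_one_forall_re_apply_add_le [NormedSpace ℝ Y] [IsScalarTower ℝ 𝕜 Y]
    {x : Y} {r : ℝ} {S : Set Y} (hr : 0 < r) (hS : Convex ℝ S) (hne : S.Nonempty)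
    (hdisj : Disjoint (Metric.ball x r) S) :
    ∃ h : StrongDual 𝕜 Y, ‖h‖ = 1 ∧ ∀ y ∈ S, RCLike.re (h y) + r ≤ RCLike.re (h x) := by
  obtain ⟨k, s, hball, hS⟩ := RCLike.geometric_hahn_banach_open (𝕜 := 𝕜) (convex_ball x r)
    Metric.isOpen_ball hS hdisj
  have hk : 0 < ‖k‖ := by
    obtain ⟨y, hy⟩ := hne
    refine norm_pos_iff.2 fun hk ↦ ?_
    have hlt := (hball x (Metric.mem_ball_self hr)).trans_le (hS y hy)
    simp [hk] at hlt
  have hkx := re_apply_add_mul_norm_le hr fun y hy ↦ (hball y hy).le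
  refine ⟨-((‖k‖⁻¹ : ℝ) : 𝕜) • k, by simp [norm_smul, hk.ne'], fun y hy ↦ ?_⟩
  have hle : ‖k‖⁻¹ * (RCLike.re (k x) + r * ‖k‖) ≤ ‖k‖⁻¹ * RCLike.re (k y) :=
    mul_le_mul_of_nonneg_left (hkx.trans (hS y hy)) (inv_nonneg.2 hk.le)
  rw [mul_add, mul_comm r, inv_mul_cancel_left₀ hk.ne'] at hle
  simp only [smul_apply, smul_eq_mul, neg_mul, map_neg, RCLike.re_ofReal_mul]
  linarith

/-- Off the slice `a < re f` the value of `f` stays away from `‖f‖`, so a small perturbation of `f`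
can only come close to its norm on the slice. -/
theorem eventually_norm_add_smul_le {f h : StrongDual 𝕜 Y} {a b : ℝ} (ha : a < ‖f‖)
    (hb : ∀ y ∈ Metric.ball (0 : Y) 1, a < RCLike.re (f y) → RCLike.re (h y) ≤ b) :
    ∀ᶠ t : ℝ in 𝓝[>] 0, ‖f + (t : 𝕜) • h‖ ≤ ‖f‖ + t * b := by
  have hsmall : ∀ᶠ t : ℝ in 𝓝[>] 0, t * (‖h‖ - b) < ‖f‖ - a := by
    have hlim : Tendsto (fun t : ℝ ↦ t * (‖h‖ - b)) (𝓝[>] 0) (𝓝 0) :=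
      ((continuous_mul_const _).tendsto' 0 0 (zero_mul _)).mono_left nhdsWithin_le_nhds
    exact hlim.eventually_lt_const (sub_pos.2 ha)
  filter_upwards [hsmall, self_mem_nhdsWithin] with t ht ht0
  rw [Set.mem_Ioi] at ht0
  suffices hball : ∀ y ∈ Metric.ball (0 : Y) 1,
      RCLike.re ((f + (t : 𝕜) • h) y) ≤ ‖f‖ + t * b by
    simpa using re_apply_add_mul_norm_le one_pos hball
  intro y hy
  have hre_le (g : StrongDual 𝕜 Y) : RCLike.re (g y) ≤ ‖g‖ :=
    (RCLike.re_le_norm _).trans (g.unit_le_opNorm y (mem_ball_zero_iff.1 hy).le)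
  simp only [add_apply, smul_apply, smul_eq_mul, map_add, RCLike.re_ofReal_mul]
  rcases lt_or_ge a (RCLike.re (f y)) with hslice | hoff
  · gcongr
    exacts [hre_le f, hb y hy hslice]
  · linarith [mul_le_mul_of_nonneg_left (hre_le h) ht0.le]

theorem IsSSDAt.exists_eventually_quotient_lt {Γ : Set (Y →L[𝕜] Y)} {u : Y} (hu : IsSSDAt Γ u)
    {ε : ℝ} (hε : 0 < ε) :
    ∃ s > (0 : ℝ), ∀ᶠ t : ℝ in 𝓝[>] 0, ∀ x ∈ invariantPoints Γ, ‖x‖ ≤ 1 →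
      (‖u + (s : 𝕜) • x‖ - 1) / s < (‖u + (t : 𝕜) • x‖ - 1) / t + ε := by
  obtain ⟨τ, hτ⟩ := hu
  have hclose := Metric.tendstoUniformlyOn_iff.1 hτ (ε / 2) (half_pos hε)
  obtain ⟨s, hs, hs0⟩ := (hclose.and self_mem_nhdsWithin).exists
  refine ⟨s, hs0, hclose.mono fun t ht x hx hx1 ↦ ?_⟩
  have hsx := abs_lt.1 (hs x ⟨hx, hx1⟩)
  have htx := abs_lt.1 (ht x ⟨hx, hx1⟩)
  linarith

/-- If no point of a thinner slice were `ε`-close to `x`, a functional `h` separating that slice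
from the ball of radius `ε` around `x` would have directional derivative at most `re h x - ε`, while
a difference quotient over a fixed step is at least `re h x - ε / 2`. -/
theorem IsSSDAt.exists_mem_slice_dist_lt {f : StrongDual 𝕜 Y} (hf : ‖f‖ = 1)
    (hS : IsSSDAt (∅ : Set (StrongDual 𝕜 Y →L[𝕜] StrongDual 𝕜 Y)) f) {ε : ℝ} (hε : 0 < ε) :
    ∃ δ > (0 : ℝ), ∀ x ∈ Metric.closedBall (0 : Y) 1, 1 - δ < RCLike.re (f x) →
      ∀ a < 1, ∃ y ∈ Metric.closedBall (0 : Y) 1, a < RCLike.re (f y) ∧ dist y x < ε := by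
  let : NormedSpace ℝ Y := NormedSpace.restrictScalars ℝ 𝕜 Y
  have : IsScalarTower ℝ 𝕜 Y := .of_algebraMap_smul fun _ _ ↦ rfl
  obtain ⟨s, hs, hquot⟩ := hS.exists_eventually_quotient_lt (half_pos hε)
  refine ⟨s * (ε / 2), by positivity, fun x hx hfx a ha ↦ ?_⟩
  by_contra! hfar
  let S : Set Y := Metric.closedBall 0 1 ∩ {y | a < RCLike.re (f y)}
  have hSconv : Convex ℝ S := (convex_closedBall 0 1).inter <|
    convex_halfSpace_gt ((RCLike.reLm.comp (f.restrictScalars ℝ).toLinearMap).isLinear) a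
  have hSne : S.Nonempty := exists_mem_closedBall_lt_re_apply (hf ▸ ha)
  have hdisj : Disjoint (Metric.ball x ε) S :=
    Set.disjoint_left.2 fun y hyx hy ↦ (hfar y hy.1 hy.2).not_gt hyx
  obtain ⟨h, hh, hsep⟩ :=
    exists_norm_eq_one_forall_re_apply_add_le (𝕜 := 𝕜) hε hSconv hSne hdisj
  have hupper : ∀ᶠ t : ℝ in 𝓝[>] 0, ‖f + (t : 𝕜) • h‖ ≤ ‖f‖ + t * (RCLike.re (h x) - ε) :=
    eventually_norm_add_smul_le (hf ▸ ha) fun y hy hay ↦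
      le_sub_iff_add_le.2 (hsep y ⟨Metric.ball_subset_closedBall hy, hay⟩)
  obtain ⟨t, ⟨hst, ht⟩, ht0⟩ := ((hquot.and hupper).and self_mem_nhdsWithin).exists
  have hqt : (‖f + (t : 𝕜) • h‖ - 1) / t ≤ RCLike.re (h x) - ε := by
    rw [div_le_iff₀ ht0]
    linarith
  have hqs : RCLike.re (h x) - ε / 2 < (‖f + (s : 𝕜) • h‖ - 1) / s := by
    have hle : RCLike.re (f x) + s * RCLike.re (h x) ≤ ‖f + (s : 𝕜) • h‖ := by
      simpa [RCLike.re_ofReal_mul] using (RCLike.re_le_norm _).trans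
        ((f + (s : 𝕜) • h).unit_le_opNorm x (mem_closedBall_zero_iff.1 hx))
    rw [lt_div_iff₀ hs]
    linarith
  linarith [hst h (fun T hT ↦ hT.elim) hh.le]

theorem exists_le_apply_of_forall_exists_dist_lt {Z : Type*} [PseudoMetricSpace Z] [CompleteSpace Z]
    {S : Set Z} (hS : IsClosed S) {φ : Z → ℝ} (hφ : Continuous φ) {M : ℝ}
    (hsup : ∀ a < M, ∃ x ∈ S, a < φ x)
    (hclose : ∀ ε > 0, ∃ δ > 0, ∀ x ∈ S, M - δ < φ x →
      ∀ a < M, ∃ y ∈ S, a < φ y ∧ dist y x < ε) :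
    ∃ x ∈ S, M ≤ φ x := by
  choose! δ hδ hnext using hclose
  let ε (n : ℕ) : ℝ := 1 / 2 / 2 ^ n
  have hε (n : ℕ) : 0 < ε n := by positivity
  let a (n : ℕ) : ℝ := M - min (δ (ε n)) (ε n)
  have ha (n : ℕ) : a n < M := sub_lt_self M (lt_min (hδ _ (hε n)) (hε n))
  have hstep (n : ℕ) (x : Z) (hx : x ∈ S ∧ a n < φ x) :
      ∃ y, (y ∈ S ∧ a (n + 1) < φ y) ∧ dist y x < ε n := by
    have hδx : M - δ (ε n) < φ x := (sub_le_sub_left (min_le_left _ _) M).trans_lt hx.2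
    obtain ⟨y, hyS, hay, hyx⟩ := hnext _ (hε n) x hx.1 hδx _ (ha (n + 1))
    exact ⟨y, ⟨hyS, hay⟩, hyx⟩
  choose! next hmem hdist using hstep
  obtain ⟨x₀, hx₀⟩ := hsup _ (ha 0)
  let u (n : ℕ) : Z := Nat.rec x₀ next n
  have hu (n : ℕ) : u n ∈ S ∧ a n < φ (u n) := by
    induction n with
    | zero => exact hx₀
    | succ n ih => exact hmem n _ ih
  have hcauchy : CauchySeq u := cauchySeq_of_le_geometric_two fun n ↦ by
    rw [dist_comm]
    exact (hdist n _ (hu n)).le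
  obtain ⟨x, hx⟩ := cauchySeq_tendsto_of_complete hcauchy
  refine ⟨x, hS.mem_of_tendsto hx (.of_forall fun n ↦ (hu n).1), ?_⟩
  have hlim : Tendsto (fun n ↦ M - ε n) atTop (𝓝 M) := by
    simpa [ε, div_eq_mul_inv] using tendsto_const_nhds.sub
      ((tendsto_pow_atTop_nhds_zero_of_lt_one (r := (2 : ℝ)⁻¹) (by norm_num)
        (by norm_num)).const_mul (2 : ℝ)⁻¹)
  refine le_of_tendsto_of_tendsto' hlim ((hφ.tendsto x).comp hx) fun n ↦ ?_
  exact (sub_le_sub_left (min_le_right _ _) M).trans (hu n).2.le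

theorem IsSSDAt.mem_NA [CompleteSpace Y] {f : StrongDual 𝕜 Y} (hf : ‖f‖ = 1)
    (hS : IsSSDAt (∅ : Set (StrongDual 𝕜 Y →L[𝕜] StrongDual 𝕜 Y)) f) : f ∈ NA 𝕜 Y := by
  obtain ⟨y, hy, hfy⟩ : ∃ y ∈ Metric.closedBall (0 : Y) 1, 1 ≤ RCLike.re (f y) :=
    exists_le_apply_of_forall_exists_dist_lt Metric.isClosed_closedBall (by fun_prop)
      (fun a ha ↦ exists_mem_closedBall_lt_re_apply (hf ▸ ha))
      (fun ε hε ↦ hS.exists_mem_slice_dist_lt hf hε)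
  rw [mem_closedBall_zero_iff] at hy
  have hnorm : ‖f y‖ ≤ ‖y‖ := by simpa [hf] using f.le_opNorm y
  have hre : RCLike.re (f y) ≤ ‖f y‖ := RCLike.re_le_norm _
  have hre_eq : RCLike.re (f y) = 1 := by linarith
  have hfy_eq : (RCLike.re (f y) : 𝕜) = f y := RCLike.re_eq_self_of_le (by linarith)
  exact ⟨y, by linarith, by rw [← hfy_eq, hre_eq, hf]⟩

end NormAttainment

section Averaging

open MeasureTheory Measure

variable {R : Type*} [NormedRing R] [NormedAlgebra ℝ R] [CompleteSpace R]

theorem isMulRightInvariant_of_isHaarMeasure {K : Type*} [Group K] [TopologicalSpace K]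
    [IsTopologicalGroup K] [LocallyCompactSpace K] [MeasurableSpace K] [BorelSpace K]
    (μ : Measure K) [IsHaarMeasure μ] [IsProbabilityMeasure μ] : μ.IsMulRightInvariant where
  map_mul_right_eq_self g := by
    have : IsProbabilityMeasure (μ.map (· * g)) :=
      isProbabilityMeasure_map (measurable_mul_const g).aemeasurable
    exact isHaarMeasure_eq_of_isProbabilityMeasure _ _

theorem exists_average_of_continuous {K : Type*} [Group K] [TopologicalSpace K]
    [IsTopologicalGroup K] [CompactSpace K] {Φ : K →* R} (hΦ : Continuous Φ) :
    ∃ p ∈ closedConvexHull ℝ (Set.range Φ), ∀ k, Φ k * p = p ∧ p * Φ k = p := by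
  borelize K
  let μ : Measure K := haarMeasure ⊤
  have : IsProbabilityMeasure μ := ⟨haarMeasure_self (K₀ := ⊤)⟩
  have := isMulRightInvariant_of_isHaarMeasure μ
  have hint : Integrable Φ μ :=
    hΦ.integrable_of_hasCompactSupport (HasCompactSupport.of_compactSpace _)
  refine ⟨∫ k, Φ k ∂μ, ?_, fun k ↦ ⟨?_, ?_⟩⟩
  · exact convex_closedConvexHull.integral_mem isClosed_closedConvexHull
      (.of_forall fun k ↦ subset_closedConvexHull (Set.mem_range_self k)) hint
  · simp only [← integral_const_mul_of_integrable hint, ← map_mul]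
    exact integral_mul_left_eq_self Φ k
  · simp only [← integral_mul_const_of_integrable hint, ← map_mul]
    exact integral_mul_right_eq_self Φ k

theorem exists_average_of_isCompact_range {K : Type*} [Group K] {Φ : K →* R}
    (hΦ : IsCompact (Set.range Φ)) :
    ∃ p ∈ closedConvexHull ℝ (Set.range Φ), ∀ k, Φ k * p = p ∧ p * Φ k = p := by
  let : TopologicalSpace K := .induced Φ.toHomUnits inferInstance
  -- Inversion on the units of a Banach algebra is continuous, so `K` is a topological group.
  have : IsTopologicalGroup K := topologicalGroup_induced Φ.toHomUnits
  have hind : IsInducing Φ := Units.isOpenEmbedding_val.isInducing.comp (g := Units.val)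
    (f := Φ.toHomUnits) ⟨rfl⟩
  have : CompactSpace K := ⟨hind.isCompact_iff.2 (by rwa [Set.image_univ])⟩
  exact exists_average_of_continuous hind.continuous

theorem map_eq_of_mem_closedConvexHull {E F : Type*} [AddCommGroup E] [Module ℝ E]
    [TopologicalSpace E] [AddCommGroup F] [Module ℝ F] [TopologicalSpace F] [T1Space F]
    (L : E →L[ℝ] F) {s : Set E} {c : F}
    (hs : ∀ x ∈ s, L x = c) {x : E} (hx : x ∈ closedConvexHull ℝ s) : L x = c :=
  closedConvexHull_min (t := L ⁻¹' {c}) hs ((convex_singleton c).linear_preimage L.toLinearMap)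
    (isClosed_singleton.preimage L.continuous) hx

end Averaging

section Duality

variable {𝕜 : Type*} [RCLike 𝕜] {X : Type*} [NormedAddCommGroup X] [NormedSpace 𝕜 X]

/-- The inclusion of a group of surjective linear isometries into the algebra of bounded
operators. -/
def toOperator (G : Subgroup (X ≃ₗᵢ[𝕜] X)) : G →* (X →L[𝕜] X) where
  toFun g := (g : X ≃ₗᵢ[𝕜] X).toContinuousLinearEquiv
  map_one' := rfl
  map_mul' _ _ := rfl

theorem range_toOperator (G : Subgroup (X ≃ₗᵢ[𝕜] X)) : Set.range (toOperator G) = operators G := by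
  ext T
  constructor
  · rintro ⟨g, rfl⟩
    exact ⟨g, g.2, fun _ ↦ rfl⟩
  · rintro ⟨g, hg, hT⟩
    exact ⟨⟨g, hg⟩, ContinuousLinearMap.ext fun x ↦ (hT x).symm⟩

theorem norm_le_one_of_mem_operators {G : Subgroup (X ≃ₗᵢ[𝕜] X)} {T : X →L[𝕜] X}
    (hT : T ∈ operators G) : ‖T‖ ≤ 1 := by
  obtain ⟨g, -, hg⟩ := hT
  exact T.opNorm_le_bound zero_le_one fun x ↦ by simp [hg]

theorem isClosed_invariantPoints (Γ : Set (X →L[𝕜] X)) : IsClosed (invariantPoints Γ : Set X) := by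
  have : (invariantPoints Γ : Set X) = ⋂ T ∈ Γ, {x | T x = x} := by
    ext x
    simp [invariantPoints]
  rw [this]
  exact isClosed_biInter fun T _ ↦ isClosed_eq (by fun_prop) (by fun_prop)

theorem exists_contractive_projection [CompleteSpace X] {G : Subgroup (X ≃ₗᵢ[𝕜] X)}
    (hG : IsCompactGroup G) :
    ∃ P : X →L[𝕜] invariantPoints (operators G), ‖P‖ ≤ 1 ∧
      (∀ y : invariantPoints (operators G), P y = y) ∧ (∀ g ∈ G, ∀ x, P (g x) = P x) ∧
      ∀ f ∈ invariantFunctionals G, ∀ x, f (P x) = f x := by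
  let : NormedAlgebra ℝ (X →L[𝕜] X) := .restrictScalars ℝ 𝕜 _
  let : NormedSpace ℝ X := .restrictScalars ℝ 𝕜 X
  have : IsScalarTower ℝ 𝕜 X := .of_algebraMap_smul fun _ _ ↦ rfl
  have : IsScalarTower ℝ 𝕜 (X →L[𝕜] X) := .of_algebraMap_smul fun _ _ ↦ rfl
  obtain ⟨p, hp, hinv⟩ := exists_average_of_isCompact_range (Φ := toOperator G)
    (by rwa [range_toOperator])
  rw [range_toOperator] at hp
  have hpY (x : X) : p x ∈ invariantPoints (operators G) := by
    rintro T ⟨g, hg, hT⟩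
    rw [hT]
    exact DFunLike.congr_fun (hinv ⟨g, hg⟩).1 x
  have hpnorm : ‖p‖ ≤ 1 := mem_closedBall_zero_iff.1 <|
    closedConvexHull_min (fun T hT ↦ mem_closedBall_zero_iff.2 (norm_le_one_of_mem_operators hT))
      (convex_closedBall 0 1) Metric.isClosed_closedBall hp
  refine ⟨p.codRestrict _ hpY, ?_, fun y ↦ Subtype.ext ?_, fun g hg x ↦ Subtype.ext ?_,
    fun f hf x ↦ ?_⟩
  · exact ContinuousLinearMap.opNorm_le_bound _ zero_le_one fun x ↦ p.le_of_opNorm_le hpnorm x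
  · exact map_eq_of_mem_closedConvexHull
      ((ContinuousLinearMap.apply 𝕜 X (y : X)).restrictScalars ℝ) (fun T hT ↦ y.2 T hT) hp
  · exact DFunLike.congr_fun (hinv ⟨g, hg⟩).2 x
  · refine map_eq_of_mem_closedConvexHull
      ((f.comp (ContinuousLinearMap.apply 𝕜 X x)).restrictScalars ℝ) ?_ hp
    rintro T ⟨g, hg, hT⟩
    exact (congrArg f (hT x)).trans (hf g hg x)

theorem exists_dual_linearIsometry_range_eq [CompleteSpace X] {G : Subgroup (X ≃ₗᵢ[𝕜] X)}
    (hG : IsCompactGroup G) :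
    ∃ J : StrongDual 𝕜 (invariantPoints (operators G)) →ₗᵢ[𝕜] StrongDual 𝕜 X,
      LinearMap.range J.toLinearMap = invariantFunctionals G ∧
        ∀ h (y : invariantPoints (operators G)), J h y = h y := by
  obtain ⟨P, hP, hPy, hPg, hPf⟩ := exists_contractive_projection hG
  let Y := invariantPoints (operators G)
  let J : StrongDual 𝕜 Y →ₗᵢ[𝕜] StrongDual 𝕜 X :=
    { toLinearMap := (ContinuousLinearMap.precomp 𝕜 P).toLinearMap
      norm_map' h := by
        refine le_antisymm ?_ (h.opNorm_le_bound (norm_nonneg _) fun y ↦ ?_)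
        · exact (h.opNorm_comp_le P).trans (mul_le_of_le_one_right (norm_nonneg h) hP)
        · simpa [hPy] using (h.comp P).le_opNorm y }
  refine ⟨J, ?_, fun h y ↦ congrArg h (hPy y)⟩
  ext f
  constructor
  · rintro ⟨h, rfl⟩ g hg x
    exact congrArg h (hPg g hg x)
  · exact fun hf ↦ ⟨f.comp Y.subtypeL, ContinuousLinearMap.ext (hPf f hf)⟩

theorem IsSSDAt.of_linearIsometry {Y : Type*} [NormedAddCommGroup Y] [NormedSpace 𝕜 Y]
    {Δ : Set (Y →L[𝕜] Y)} {Γ : Set (X →L[𝕜] X)} (J : Y →ₗᵢ[𝕜] X)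
    (hJ : ∀ y ∈ invariantPoints Δ, J y ∈ invariantPoints Γ) {v : Y} (hv : IsSSDAt Γ (J v)) :
    IsSSDAt Δ v := by
  obtain ⟨τ, hτ⟩ := hv
  refine ⟨τ ∘ J, ((hτ.comp J).mono fun y hy ↦ ⟨hJ y hy.1, by simpa using hy.2⟩).congr ?_⟩
  refine .of_forall fun t y _ ↦ ?_
  simp only [Function.comp_apply, ← map_smul, ← map_add, J.norm_map]

theorem IsSSDAt.mem_NA_of_mem_invariantFunctionals [CompleteSpace X]
    {G : Subgroup (X ≃ₗᵢ[𝕜] X)} (hG : IsCompactGroup G) {u : StrongDual 𝕜 X}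
    (hu : u ∈ invariantFunctionals G) (hu1 : ‖u‖ = 1)
    (hS : IsSSDAt (dualOperators (operators G)) u) : u ∈ NA 𝕜 X := by
  have : CompleteSpace (invariantPoints (operators G)) :=
    (isClosed_invariantPoints _).completeSpace_coe
  obtain ⟨J, hrange, hJ⟩ := exists_dual_linearIsometry_range_eq hG
  obtain ⟨v, rfl⟩ : u ∈ LinearMap.range J.toLinearMap := hrange ▸ hu
  have hmem (h : StrongDual 𝕜 (invariantPoints (operators G))) :
      J h ∈ invariantPoints (dualOperators (operators G)) := by
    rw [invariantPoints_dualOperators, ← hrange]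
    exact ⟨h, rfl⟩
  have hv1 : ‖v‖ = 1 := (J.norm_map v).symm.trans hu1
  obtain ⟨y, hy, hvy⟩ := (hS.of_linearIsometry (Δ := ∅) J fun h _ ↦ hmem h).mem_NA hv1
  exact ⟨y, hy, (hJ v y).trans (hvy.trans (by rw [hv1, hu1]))⟩

theorem zero_mem_NA [Nontrivial X] : (0 : StrongDual 𝕜 X) ∈ NA 𝕜 X := by
  obtain ⟨x, hx⟩ := exists_ne (0 : X)
  exact ⟨_, norm_smul_inv_norm (𝕜 := 𝕜) hx, by simp⟩

theorem ofReal_smul_mem_NA {f : StrongDual 𝕜 X} (hf : f ∈ NA 𝕜 X) {c : ℝ} (hc : 0 ≤ c) :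
    (c : 𝕜) • f ∈ NA 𝕜 X := by
  obtain ⟨x, hx, hfx⟩ := hf
  exact ⟨x, hx, by simp [hfx, norm_smul, abs_of_nonneg hc]⟩

theorem isClosed_invariantFunctionals (G : Subgroup (X ≃ₗᵢ[𝕜] X)) :
    IsClosed (invariantFunctionals G : Set (StrongDual 𝕜 X)) :=
  invariantPoints_dualOperators G ▸ isClosed_invariantPoints _

theorem DualIsGSSD.invariantFunctionals_subset_NA [CompleteSpace X] [Nontrivial X]
    {G : Subgroup (X ≃ₗᵢ[𝕜] X)} (hG : IsCompactGroup G) (hSSD : DualIsGSSD G) :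
    (invariantFunctionals G : Set (StrongDual 𝕜 X)) ⊆ NA 𝕜 X := by
  intro f hf
  rcases eq_or_ne f 0 with rfl | hf0
  · exact zero_mem_NA
  have hu : (‖f‖ : 𝕜)⁻¹ • f ∈ invariantFunctionals G := Submodule.smul_mem _ _ hf
  have hu1 : ‖(‖f‖ : 𝕜)⁻¹ • f‖ = 1 := norm_smul_inv_norm hf0
  have hS : IsSSDAt (dualOperators (operators G)) ((‖f‖ : 𝕜)⁻¹ • f) :=
    hSSD _ (by rwa [invariantPoints_dualOperators]) hu1
  have hmem := hS.mem_NA_of_mem_invariantFunctionals hG hu hu1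
  rw [← smul_inv_smul₀ (show (‖f‖ : 𝕜) ≠ 0 by simpa using hf0) f]
  exact ofReal_smul_mem_NA hmem (norm_nonneg f)

end Duality

end GroupInvariant

theorem mainTheorem2 {𝕜 : Type*} [RCLike 𝕜] {X : Type*} [NormedAddCommGroup X]
    [NormedSpace 𝕜 X] [CompleteSpace X] [Nontrivial X]
    (G : Subgroup (X ≃ₗᵢ[𝕜] X)) (hG : GroupInvariant.IsCompactGroup G)
    (hSSD : GroupInvariant.DualIsGSSD G) :
    (∀ f : StrongDual 𝕜 X, (∀ g ∈ G, ∀ x, f (g x) = f x) →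
        ∃ x : X, ‖x‖ = 1 ∧ f x = (‖f‖ : 𝕜)) ∧
      IsClosed (GroupInvariant.invariantFunctionals G : Set (StrongDual 𝕜 X)) ∧
      (GroupInvariant.invariantFunctionals G : Set (StrongDual 𝕜 X)) ⊆
        GroupInvariant.NA 𝕜 X := by
  have hNA := hSSD.invariantFunctionals_subset_NA hG
  exact ⟨fun f hf ↦ hNA hf, GroupInvariant.isClosed_invariantFunctionals G, hNA⟩
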